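/- Let $p$ be a prime with $p\equiv 1\pmod 3$, let $q$ be a prime with $q\equiv 1\pmod 4$, and suppose that $p$ is a quadratic residue modulo $q$. Let $\mathcal R=\mathbb F_p+u\mathbb F_p+u^2\mathbb F_p+u^3\mathbb F_p$ with $u^4=u$, that is, $\mathcal R=\mathbb F_p[X]/(X^4-X)$. Let $\alpha$ be a primitive element of $\mathbb F_p$, $\xi=\alpha^{(p-1)/3}$, and $$\eta_1=1-u^3,\quad \eta_2=3^{-1}(u+u^2+u^3),\quad \eta_3=3^{-1}(\xi u+\xi^2u^2+u^3),\quad \eta_4=3^{-1}(\xi^2u+\xi u^2+u^3).$$ Let $\beta$ be a primitive $q$th root of unity in an extension field of $\mathbb F_p$ and let $\theta=\sum_{i=1}^{q-1}\left(\frac iq\right)\beta^i$. Then $\theta\in\mathbb F_p$. Let $j_1(x)$ and $j_2(x)$ be the sums of $x^i$ over the quadratic residues, respectively non-residues, $i$ modulo $q$ with $0<i<q$, and put $$\tilde e_1=\tfrac12\left(1-\tfrac1q\right)-\tfrac12\left(\tfrac1q+\tfrac1\theta\right)j_1-\tfrac12\left(\tfrac1q-\tfrac1\theta\right)j_2,\qquad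 \tilde e_2=\tfrac12\left(1-\tfrac1q\right)-\tfrac12\left(\tfrac1q+\tfrac1\theta\right)j_2-\tfrac12\left(\tfrac1q-\tfrac1\theta\right)j_1$$ in $\mathbb F_p[x]$. For $1\le i\le 14$ let $S_i$ be the cyclic code of length $q$ over $\mathcal R$ (the ideal of $\mathcal R[x]/(x^q-1)$, a polynomial being identified with its vector of coefficients) generated by $\eta_1\tilde e_a+\eta_2\tilde e_b+\eta_3\tilde e_c+\eta_4\tilde e_d$, where $(a,b,c,d)$ is, for $i=1,\dots,14$ respectively, $$2111,\ 1211,\ 1121,\ 1112,\ 1222,\ 2122,\ 2212,\ 2221,\ 1122,\ 1212,\ 1221,\ 2211,\ 2121,\ 2112 .$$ Let $r_i=1$ for $i\in\{1,2,3,4,9,10,11\}$ and $r_i=-q$ for $i\in\{5,6,7,8,12,13,14\}$. The extended quadratic residue code $\overline{Q_i}$ is the $\mathcal R$-submodule of $\mathcal R^{q+1}$ (coordinates labelled $\infty,0,1,\dots,q-1$) generated by the words $(0\,|\,s)$ with $s\in S_i$ together with the word $(r_i\,|\,1,1,\dots,1)$. With $\perp$ denoting the dual with respect to the Euclidean inner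 product on $\mathcal R^{q+1}$, $$\overline{Q_i}^{\perp}=\overline{Q_{i+4}}\quad(i=1,2,3,4),\qquad \overline{Q_i}^{\perp}=\overline{Q_{i+3}}\quad(i=9,10,11).$$ -/

import Mathlib

open Polynomial

noncomputable section

/-- The ring `R = F_p + u F_p + u² F_p + u³ F_p` with `u⁴ = u`, as `F_p[X] / (X⁴ - X)`. -/
abbrev QRRing (p : ℕ) : Type := AdjoinRoot (X ^ 4 - X : (ZMod p)[X])

/-- The element `u` of `R`. -/
def uElt (p : ℕ) : QRRing p := AdjoinRoot.root (X ^ 4 - X : (ZMod p)[X])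

/-- The idempotents `η₁, η₂, η₃, η₄` of `R` attached to a cube root of unity `ξ` of `F_p`
(indexed by `0, 1, 2, 3`). -/
def etaIdem (p : ℕ) (ξ : ZMod p) : Fin 4 → QRRing p :=
  ![1 - uElt p ^ 3,
    (3⁻¹ : ZMod p) • (uElt p + uElt p ^ 2 + uElt p ^ 3),
    (3⁻¹ : ZMod p) • (ξ • uElt p + ξ ^ 2 • uElt p ^ 2 + uElt p ^ 3),
    (3⁻¹ : ZMod p) • (ξ ^ 2 • uElt p + ξ • uElt p ^ 2 + uElt p ^ 3)]

/-- The Gaussian sum `∑_{i=1}^{q-1} χ(i) βⁱ`, with `χ` the Legendre symbol modulo `q`. -/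
def gaussianSum (q : ℕ) [Fact q.Prime] {K : Type*} [Field K] (β : K) : K :=
  ∑ i ∈ Finset.Icc 1 (q - 1), (legendreSym q (i : ℤ) : K) * β ^ i

/-- `j₁(x)`, the sum of `xⁱ` over the quadratic residues `i` modulo `q`, `0 < i < q`. -/
def jRes (p q : ℕ) [Fact q.Prime] : (ZMod p)[X] :=
  ∑ i ∈ Finset.Icc 1 (q - 1), if legendreSym q (i : ℤ) = 1 then X ^ i else 0

/-- `j₂(x)`, the sum of `xⁱ` over the quadratic non-residues `i` modulo `q`, `0 < i < q`. -/
def jNonres (p q : ℕ) [Fact q.Prime] : (ZMod p)[X] :=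
  ∑ i ∈ Finset.Icc 1 (q - 1), if legendreSym q (i : ℤ) = -1 then X ^ i else 0

/-- The idempotent generators `ẽ₁ = F_q(x)` (index `0`) and `ẽ₂ = F_n(x)` (index `1`) of the two
expurgated quadratic residue codes over `F_p`; `θ` is the Gaussian sum. -/
def expIdem (p q : ℕ) [Fact p.Prime] [Fact q.Prime] (θ : ZMod p) : Fin 2 → (ZMod p)[X] :=
  ![C (2⁻¹ * (1 - (q : ZMod p)⁻¹)) - C (2⁻¹ * ((q : ZMod p)⁻¹ + θ⁻¹)) * jRes p q
      - C (2⁻¹ * ((q : ZMod p)⁻¹ - θ⁻¹)) * jNonres p q,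
    C (2⁻¹ * (1 - (q : ZMod p)⁻¹)) - C (2⁻¹ * ((q : ZMod p)⁻¹ + θ⁻¹)) * jNonres p q
      - C (2⁻¹ * ((q : ZMod p)⁻¹ - θ⁻¹)) * jRes p q]

/-- For the fourteen codes, which of the two classical idempotents stands at each of
`η₁, η₂, η₃, η₄`: `0` for the first one, `1` for the second. (Only `1 ≤ i ≤ 14` is used.) -/
def qrPattern : ℕ → Fin 4 → Fin 2
  | 1 => ![1, 0, 0, 0]
  | 2 => ![0, 1, 0, 0]
  | 3 => ![0, 0, 1, 0]
  | 4 => ![0, 0, 0, 1]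
  | 5 => ![0, 1, 1, 1]
  | 6 => ![1, 0, 1, 1]
  | 7 => ![1, 1, 0, 1]
  | 8 => ![1, 1, 1, 0]
  | 9 => ![0, 0, 1, 1]
  | 10 => ![0, 1, 0, 1]
  | 11 => ![0, 1, 1, 0]
  | 12 => ![1, 1, 0, 0]
  | 13 => ![1, 0, 1, 0]
  | 14 => ![1, 0, 0, 1]
  | _ => ![0, 0, 0, 0]

/-- The identification of a word `c` of length `q` (coordinates labelled by `F_q`) with the
class of `c₀ + c₁ x + ⋯ + c_{q-1} x^{q-1}` in `S[x] / (x^q - 1)`. -/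
def wordToPoly (q : ℕ) [Fact q.Prime] (S : Type*) [CommRing S] :
    (ZMod q → S) →ₗ[S] AdjoinRoot (X ^ q - 1 : S[X]) :=
  Fintype.linearCombination S
    (fun i : ZMod q => AdjoinRoot.root (X ^ q - 1 : S[X]) ^ i.val)

/-- The cyclic code of length `q` over `S` generated by the polynomial `g`. -/
def cyclicCode (q : ℕ) [Fact q.Prime] {S : Type*} [CommRing S] (g : S[X]) :
    Submodule S (ZMod q → S) :=
  ((Ideal.span {AdjoinRoot.mk (X ^ q - 1 : S[X]) g}).restrictScalars S).comap (wordToPoly q S)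

/-- The generator `η₁ ẽ_a + η₂ ẽ_b + η₃ ẽ_c + η₄ ẽ_d` of the `i`-th expurgated code over `R`. -/
def expGen (p q : ℕ) [Fact p.Prime] [Fact q.Prime] (ξ θ : ZMod p) (i : ℕ) : (QRRing p)[X] :=
  ∑ k : Fin 4, C (etaIdem p ξ k) *
    (expIdem p q θ (qrPattern i k)).map (algebraMap (ZMod p) (QRRing p))

/-- The expurgated quadratic residue code `S_i` over `R`. -/
def expCode (p q : ℕ) [Fact p.Prime] [Fact q.Prime] (ξ θ : ZMod p) (i : ℕ) :
    Submodule (QRRing p) (ZMod q → QRRing p) :=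
  cyclicCode q (expGen p q ξ θ i)

/-- The entry `r_i` in the extra column, for `q ≡ 1 (mod 4)`: `-q` for `i = 5, …, 8, 12, 13, 14`,
and `1` for `i = 1, …, 4, 9, 10, 11`. -/
def extEntry (p q : ℕ) (i : ℕ) : QRRing p :=
  if i ∈ ({5, 6, 7, 8, 12, 13, 14} : Finset ℕ) then -(q : QRRing p) else 1

/-- The extended quadratic residue code `Q̄_i` of length `q + 1` over `R`, with coordinates
labelled by `F_q ∪ {∞}` (`none` is `∞`): it is generated by the rows `(0 | s)`, `s ∈ S_i`, and
the row `(r_i | 1, 1, …, 1)`. -/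
def extCode (p q : ℕ) [Fact p.Prime] [Fact q.Prime] (ξ θ : ZMod p) (i : ℕ) :
    Submodule (QRRing p) (Option (ZMod q) → QRRing p) :=
  Submodule.span (QRRing p)
    ({v | v none = 0 ∧ (fun j : ZMod q => v (some j)) ∈ expCode p q ξ θ i} ∪
      {fun t : Option (ZMod q) => t.elim (extEntry p q i) (fun _ => 1)})

/-- The dual code with respect to the Euclidean inner product. -/
def dualCode {S ι : Type*} [CommRing S] [Fintype ι] (D : Submodule S (ι → S)) :
    Submodule S (ι → S) where
  carrier := {x | ∀ y ∈ D, ∑ t, x t * y t = 0}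
  add_mem' := by
    intro a b ha hb y hy
    simp only [Pi.add_apply, add_mul, Finset.sum_add_distrib, ha y hy, hb y hy, add_zero]
  zero_mem' := by
    intro y _
    simp
  smul_mem' := by
    intro c x hx y hy
    simp only [Pi.smul_apply, smul_eq_mul, mul_assoc, ← Finset.mul_sum, hx y hy, mul_zero]

end

/-! In `S[x]/(x^q - 1)` put T = ∑ xⁱ and G = ∑ χ(i) xⁱ, with χ the quadratic character. Then G² = q
- T, TG = 0 and T² = qT. Each generator becomes g = ½(1 - T/q - lG), where l = θ⁻¹ ∑ ±η_k. Since the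
η_k are orthogonal idempotents with sum 1 (`etaIdem_signed_sum_sq`) and θ² = q, one has l²q = 1. All
14 codes are thus treated at once over the ring, without splitting it by the Chinese remainder
theorem.

Complementary patterns replace l by -l and give g' with gg' = 0, Tg = Tg' = 0 and g + g' + T/q = 1.
As χ(-1) = 1, g is fixed by x ↦ x⁻¹, and the inner product of v and w is the constant coefficient of
v(x)w(x⁻¹). Hence the dual of the cyclic code of g is its annihilator, spanned by the code of g' and
the all-ones word; the extra column accounts for that word because rr' = -q (`dualCode_augCode`).

That θ lies in F_p follows from quadratic reciprocity (`exists_gaussianSum_eq`). -/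

/-- The quadratic Gauss sum of an additive character of `ZMod q` with values in any commutative
ring. -/
def quadSum {q : ℕ} [Fact q.Prime] {A : Type*} [CommRing A] (ψ : AddChar (ZMod q) A) : A :=
  gaussSum ((quadraticChar (ZMod q)).ringHomComp (Int.castRingHom A)) ψ

/-! ### Quadratic Gauss sums over a commutative ring. -/

section GaussSums

variable {q : ℕ} [Fact q.Prime] {A : Type*} [CommRing A]

theorem quadSum_eq (ψ : AddChar (ZMod q) A) :
    quadSum ψ = ∑ i, ((quadraticChar (ZMod q) i : ℤ) : A) * ψ i := rfl

theorem ringChar_zmod_ne_two (hq : q ≠ 2) : ringChar (ZMod q) ≠ 2 := by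
  rwa [ZMod.ringChar_zmod_n]

theorem quadraticChar_neg_one_of_mod_four (hq : q % 4 = 1) :
    quadraticChar (ZMod q) (-1) = 1 := by
  rw [quadraticChar_neg_one (ringChar_zmod_ne_two (by lia)), ZMod.card,
    ZMod.χ₄_nat_one_mod_four hq]

/-- The convolution of the quadratic character with itself. -/
theorem sum_quadraticChar_mul_sub (hq : q % 4 = 1) (t : ZMod q) :
    ∑ x, quadraticChar (ZMod q) x * quadraticChar (ZMod q) (t - x) =
      (if t = 0 then (q : ℤ) else 0) - 1 := by
  have h2 : ringChar (ZMod q) ≠ 2 := ringChar_zmod_ne_two (by lia)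
  have hinv : (quadraticChar (ZMod q))⁻¹ = quadraticChar (ZMod q) :=
    (quadraticChar_isQuadratic (ZMod q)).inv
  split_ifs with ht
  · subst ht
    have h : ∀ x : ZMod q, quadraticChar (ZMod q) x * quadraticChar (ZMod q) (0 - x) =
        1 - if x = 0 then 1 else 0 := by
      intro x
      rw [zero_sub, neg_eq_neg_one_mul, map_mul, quadraticChar_neg_one_of_mod_four hq, one_mul,
        ← sq]
      split_ifs with hx
      · simp [hx]
      · rw [quadraticChar_sq_one hx, sub_zero]
    rw [Finset.sum_congr rfl fun x _ => h x]
    simp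
  -- For t ≠ 0, substituting tx for x gives χ(t)² = 1 times the Jacobi sum J(χ, χ⁻¹) = -χ(-1) = -1.
  · have h := jacobiSum_nontrivial_inv (quadraticChar_ne_one h2)
    rw [hinv, quadraticChar_neg_one_of_mod_four hq, jacobiSum] at h
    rw [zero_sub, ← h, ← Equiv.sum_comp (Equiv.mulLeft₀ t ht)]
    refine Finset.sum_congr rfl fun x _ => ?_
    have h1 : t - t * x = t * (1 - x) := by ring
    simp only [Equiv.mulLeft₀_apply, h1, map_mul]
    linear_combination (quadraticChar (ZMod q) x * quadraticChar (ZMod q) (1 - x)) *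
      quadraticChar_sq_one ht

/-- The character sum is kept because ψ is arbitrary: it is T for the powers of x, and it vanishes
for the powers of β. -/
theorem quadSum_sq (hq : q % 4 = 1) (ψ : AddChar (ZMod q) A) :
    quadSum ψ ^ 2 = q - ∑ i, ψ i := by
  rw [sq, quadSum, gaussSum_mul]
  have h : ∀ t : ZMod q, ∑ x, ((quadraticChar (ZMod q)).ringHomComp (Int.castRingHom A)) x *
      ((quadraticChar (ZMod q)).ringHomComp (Int.castRingHom A)) (t - x) * ψ t =
      (if t = 0 then (q : A) else 0) - ψ t := by
    intro t
    have h1 := congrArg (Int.cast : ℤ → A) (sum_quadraticChar_mul_sub hq t)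
    push_cast at h1
    rw [← Finset.sum_mul]
    simp only [MulChar.ringHomComp_apply, eq_intCast]
    rw [h1]
    split_ifs with ht
    · simp [ht]
    · ring
  rw [Finset.sum_congr rfl fun t _ => h t]
  simp

theorem sum_addChar_mul (ψ : AddChar (ZMod q) A) (a : ZMod q) :
    (∑ i, ψ i) * ψ a = ∑ i, ψ i := by
  rw [Finset.sum_mul, ← Equiv.sum_comp (Equiv.addRight a) ψ]
  simp [AddChar.map_add_eq_mul]

theorem sum_addChar_mul_quadSum (hq : q ≠ 2) (ψ : AddChar (ZMod q) A) :
    (∑ i, ψ i) * quadSum ψ = 0 := by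
  rw [quadSum_eq, Finset.mul_sum]
  simp_rw [mul_left_comm (∑ i, ψ i), sum_addChar_mul]
  rw [← Finset.sum_mul, ← Int.cast_sum, quadraticChar_sum_zero (ringChar_zmod_ne_two hq)]
  simp

theorem sum_addChar_mul_self (ψ : AddChar (ZMod q) A) :
    (∑ i, ψ i) * (∑ i, ψ i) = q * ∑ i, ψ i := by
  rw [Finset.mul_sum]
  simp [sum_addChar_mul]

/-- Since c ≠ 0, the class i = 0, absent on the left, contributes nothing on the right. -/
theorem sum_ite_quadraticChar_zmod (ψ : ZMod q → A) (c : ℤ) (hc : c ≠ 0) :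
    ∑ i ∈ Finset.Icc 1 (q - 1), (if legendreSym q (i : ℤ) = c then ψ i else 0) =
      ∑ i, if quadraticChar (ZMod q) i = c then ψ i else 0 := by
  refine Finset.sum_bij_ne_zero (fun i _ _ => (i : ZMod q)) (fun _ _ _ => Finset.mem_univ _)
    ?_ ?_ ?_
  · intro a ha _ b hb _ h
    rw [Finset.mem_Icc] at ha hb
    rw [ZMod.natCast_eq_natCast_iff'] at h
    rwa [Nat.mod_eq_of_lt (by lia), Nat.mod_eq_of_lt (by lia)] at h
  · intro b _ hb
    have hb0 : b ≠ 0 := by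
      rintro rfl
      simp [hc.symm] at hb
    refine ⟨b.val, ?_, ?_, by simp⟩
    · have := ZMod.val_lt b
      have : b.val ≠ 0 := by simpa using hb0
      rw [Finset.mem_Icc]
      lia
    · simpa [legendreSym] using hb
  · intro i _ _
    simp [legendreSym]

theorem gaussianSum_eq_quadSum {K : Type*} [Field K] {β : K} (hβ : β ^ q = 1) :
    gaussianSum q β = quadSum (AddChar.zmodChar q hβ) := by
  have hsplit : ∀ z : ZMod q, ((quadraticChar (ZMod q) z : ℤ) : K) =
      (if quadraticChar (ZMod q) z = 1 then 1 else 0) -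
        (if quadraticChar (ZMod q) z = -1 then 1 else 0) := by
    intro z
    by_cases hz : z = 0
    · simp [hz]
    · rcases quadraticChar_dichotomy hz with h | h <;> simp [h]
  have h1 := sum_ite_quadraticChar_zmod (q := q) (AddChar.zmodChar q hβ) 1 one_ne_zero
  have h2 := sum_ite_quadraticChar_zmod (q := q) (AddChar.zmodChar q hβ) (-1) (by norm_num)
  rw [quadSum_eq]
  simp_rw [hsplit, sub_mul, ite_mul, one_mul, zero_mul]
  rw [Finset.sum_sub_distrib, ← h1, ← h2, ← Finset.sum_sub_distrib, gaussianSum]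
  refine Finset.sum_congr rfl fun i _ => ?_
  rw [AddChar.zmodChar_apply', legendreSym, hsplit]
  simp [sub_mul]

end GaussSums

/-! ### The algebra `S[x]/(x^q - 1)`, cyclic codes and duality of their extensions. -/

section CyclicAlgebra

variable (q : ℕ) (S : Type*) [CommRing S]

theorem root_X_pow_sub_one_pow :
    AdjoinRoot.root (X ^ q - 1 : S[X]) ^ q = 1 := by
  have h := AdjoinRoot.eval₂_root (X ^ q - 1 : S[X])
  simpa [sub_eq_zero] using h

variable [Fact q.Prime]

/-- The powers of `x` in `S[x] / (x^q - 1)`, as a character of `ZMod q`. -/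
noncomputable def rootChar : AddChar (ZMod q) (AdjoinRoot (X ^ q - 1 : S[X])) :=
  AddChar.zmodChar q (root_X_pow_sub_one_pow q S)

variable {q S}

theorem wordToPoly_eq_sum (w : ZMod q → S) :
    wordToPoly q S w = ∑ i, w i • rootChar q S i := rfl

theorem rootChar_natCast (n : ℕ) :
    rootChar q S (n : ZMod q) = AdjoinRoot.root (X ^ q - 1 : S[X]) ^ n :=
  AddChar.zmodChar_apply' _ n

theorem wordToPoly_surjective : Function.Surjective (wordToPoly q S) := by
  rw [← LinearMap.range_eq_top, eq_top_iff]
  rintro x -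
  induction x using AdjoinRoot.induction_on with
  | ih f =>
    induction f using Polynomial.induction_on' with
    | add f g hf hg =>
      rw [map_add]
      exact add_mem hf hg
    | monomial n a =>
      rw [← C_mul_X_pow_eq_monomial, map_mul, map_pow, AdjoinRoot.mk_X, AdjoinRoot.mk_C,
        ← rootChar_natCast, ← AdjoinRoot.algebraMap_eq, ← Algebra.smul_def]
      refine Submodule.smul_mem _ _ ⟨Pi.single (n : ZMod q) 1, ?_⟩
      rw [wordToPoly_eq_sum, Finset.sum_eq_single (n : ZMod q)]
      · simp
      · intro b _ hb
        simp [hb]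
      · simp

variable (q S) in
/-- The constant coefficient, as a linear form on `S[x] / (x^q - 1)`. -/
noncomputable def constForm : AdjoinRoot (X ^ q - 1 : S[X]) →ₗ[S] S :=
  Polynomial.lcoeff S 0 ∘ₗ
    AdjoinRoot.modByMonicHom (monic_X_pow_sub_C (1 : S) (Fact.out : q.Prime).ne_zero)

theorem constForm_rootChar (a : ZMod q) :
    constForm q S (rootChar q S a) = if a = 0 then 1 else 0 := by
  rcases subsingleton_or_nontrivial S with h | h
  · exact Subsingleton.elim _ _
  have h1 : rootChar q S a = AdjoinRoot.mk (X ^ q - 1 : S[X]) (X ^ a.val) := by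
    rw [map_pow, AdjoinRoot.mk_X]
    rfl
  have hm := monic_X_pow_sub_C (1 : S) (Fact.out : q.Prime).ne_zero
  have h2 : (X ^ a.val : S[X]) %ₘ (X ^ q - C 1) = X ^ a.val := by
    rw [modByMonic_eq_self_iff hm, degree_X_pow, degree_X_pow_sub_C (Fact.out : q.Prime).pos]
    exact_mod_cast ZMod.val_lt a
  have h3 : constForm q S (rootChar q S a) = ((X ^ a.val : S[X]) %ₘ (X ^ q - C 1)).coeff 0 := by
    rw [h1]
    rfl
  rw [h3, h2, coeff_X_pow]
  simp only [eq_comm (a := 0), ZMod.val_eq_zero]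

variable (q S) in
/-- The involution `x ↦ x⁻¹` of `S[x] / (x^q - 1)`. -/
noncomputable def reversal :
    AdjoinRoot (X ^ q - 1 : S[X]) →ₐ[S] AdjoinRoot (X ^ q - 1 : S[X]) :=
  AdjoinRoot.liftAlgHom _ (Algebra.ofId S _) (rootChar q S (-1)) (by
    simp [← AddChar.map_nsmul_eq_pow])

theorem reversal_rootChar (a : ZMod q) :
    reversal q S (rootChar q S a) = rootChar q S (-a) := by
  have h1 : rootChar q S a = AdjoinRoot.root (X ^ q - 1 : S[X]) ^ a.val := rfl
  have h2 : reversal q S (AdjoinRoot.root (X ^ q - 1 : S[X])) = rootChar q S (-1) :=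
    AdjoinRoot.liftAlgHom_root ..
  rw [h1, map_pow, h2, ← AddChar.map_nsmul_eq_pow]
  simp

theorem reversal_sum_rootChar :
    reversal q S (∑ i, rootChar q S i) = ∑ i, rootChar q S i := by
  simp only [map_sum, reversal_rootChar]
  exact Equiv.sum_comp (Equiv.neg _) _

/-- The Euclidean inner product of two words in terms of the corresponding polynomials. -/
theorem sum_mul_eq_constForm (v w : ZMod q → S) :
    ∑ i, v i * w i =
      constForm q S (wordToPoly q S v * reversal q S (wordToPoly q S w)) := by
  simp only [wordToPoly_eq_sum, map_sum, map_smul, reversal_rootChar, Finset.sum_mul_sum,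
    smul_mul_smul_comm, ← AddChar.map_add_eq_mul, constForm_rootChar, ← sub_eq_add_neg,
    sub_eq_zero]
  simp

theorem constForm_wordToPoly_mul (v : ZMod q → S) (a : ZMod q) :
    constForm q S (wordToPoly q S v * rootChar q S (-a)) = v a := by
  simp only [wordToPoly_eq_sum, Finset.sum_mul, map_sum, smul_mul_assoc, map_smul,
    ← AddChar.map_add_eq_mul, constForm_rootChar, ← sub_eq_add_neg, sub_eq_zero]
  simp

/-- Nondegeneracy of the trace-like form: its values against the powers of x are the coefficients of
y. -/
theorem eq_zero_of_constForm {y : AdjoinRoot (X ^ q - 1 : S[X])}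
    (h : ∀ a, constForm q S (y * rootChar q S (-a)) = 0) : y = 0 := by
  obtain ⟨v, rfl⟩ := wordToPoly_surjective y
  simp only [constForm_wordToPoly_mul] at h
  rw [funext h]
  exact map_zero _

theorem mem_cyclicCode {g : S[X]} {w : ZMod q → S} :
    w ∈ cyclicCode q g ↔ AdjoinRoot.mk (X ^ q - 1 : S[X]) g ∣ wordToPoly q S w :=
  Ideal.mem_span_singleton

theorem wordToPoly_const (c : S) :
    wordToPoly q S (fun _ => c) = c • ∑ i, rootChar q S i := by
  rw [wordToPoly_eq_sum, Finset.smul_sum]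

/-- The code generated by the words `(0 | s)`, with `s` in the cyclic code of `g`, and the word
`(r | 1, …, 1)`. -/
def augCode (g : S[X]) (r : S) : Submodule S (Option (ZMod q) → S) :=
  Submodule.span S
    ({v | v none = 0 ∧ (fun j : ZMod q => v (some j)) ∈ cyclicCode q g} ∪
      {fun t : Option (ZMod q) => t.elim r (fun _ => 1)})

/-- It suffices to pair generators: two cyclic words by gg' = 0, a cyclic word with the border row
by Tg = Tg' = 0, and the border rows by rr' + q = 0. -/
theorem augCode_le_dualCode {g g' : S[X]} {r r' : S} (hr : r * r' = -q)
    (hmul : AdjoinRoot.mk (X ^ q - 1 : S[X]) g * AdjoinRoot.mk (X ^ q - 1 : S[X]) g' = 0)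
    (hT : (∑ i, rootChar q S i) * AdjoinRoot.mk (X ^ q - 1 : S[X]) g = 0)
    (hT' : (∑ i, rootChar q S i) * AdjoinRoot.mk (X ^ q - 1 : S[X]) g' = 0)
    (hg : reversal q S (AdjoinRoot.mk (X ^ q - 1 : S[X]) g) =
      AdjoinRoot.mk (X ^ q - 1 : S[X]) g) :
    augCode g' r' ≤ dualCode (augCode (q := q) g r) := by
  have key : ∀ f : S[X], (∑ i, rootChar q S i) * AdjoinRoot.mk (X ^ q - 1 : S[X]) f = 0 →
      ∀ v ∈ cyclicCode q f, ∑ i, v i = 0 := by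
    intro f hf v hv
    obtain ⟨b, hb⟩ := mem_cyclicCode.1 hv
    have h := sum_mul_eq_constForm v (fun _ : ZMod q => (1 : S))
    rw [wordToPoly_const, one_smul, reversal_sum_rootChar, hb, mul_comm, ← mul_assoc, hf] at h
    simpa using h
  refine Submodule.span_le.2 fun x hx y hy => ?_
  refine Submodule.span_induction (p := fun y _ => ∑ t, x t * y t = 0) ?_ ?_ ?_ ?_ hy
  · intro y hy
    rw [Fintype.sum_option]
    rcases hx with ⟨hx0, hx⟩ | rfl <;> rcases hy with ⟨hy0, hy⟩ | rfl
    · rw [hx0, zero_mul, zero_add, sum_mul_eq_constForm (fun i => x (some i))]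
      obtain ⟨b, hb⟩ := mem_cyclicCode.1 hx
      obtain ⟨c, hc⟩ := mem_cyclicCode.1 hy
      rw [hb, hc, map_mul (reversal q S), hg]
      convert map_zero (constForm q S) using 2
      linear_combination (b * reversal q S c) * hmul
    · simpa [hx0] using key g' hT' _ hx
    · simpa [hy0] using key g hT _ hy
    · simp [mul_comm r', hr]
  · simp
  · intro a b _ _ ha hb
    simp [mul_add, Finset.sum_add_distrib, ha, hb]
  · intro c a _ ha
    simp only [Pi.smul_apply, smul_eq_mul, mul_left_comm _ c, ← Finset.mul_sum, ha, mul_zero]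

/-- Orthogonality to the cyclic part forces gw = 0, so w = g'w + nTw. Here Tw is a multiple of T, so
w is a word of the code of g' plus a constant word. No dimension count is needed, so S may be any
commutative ring. -/
theorem dualCode_augCode_le {g g' : S[X]} {r r' n : S} (hr : r * r' = -q) (hn : n * q = 1)
    (hadd : AdjoinRoot.mk (X ^ q - 1 : S[X]) g + AdjoinRoot.mk (X ^ q - 1 : S[X]) g' +
      n • ∑ i, rootChar q S i = 1)
    (hg : reversal q S (AdjoinRoot.mk (X ^ q - 1 : S[X]) g) =
      AdjoinRoot.mk (X ^ q - 1 : S[X]) g) :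
    dualCode (augCode (q := q) g r) ≤ augCode g' r' := by
  intro x hx
  set w : ZMod q → S := fun i => x (some i) with hw
  have horth : ∀ c ∈ cyclicCode q g, ∑ i, w i * c i = 0 := by
    intro c hc
    have h := hx (fun t => t.elim 0 c) (Submodule.subset_span (Or.inl ⟨rfl, hc⟩))
    simpa [Fintype.sum_option] using h
  have hsum : x none * r + ∑ i, w i = 0 := by
    have h := hx _ (Submodule.subset_span (Or.inr rfl))
    simpa [Fintype.sum_option] using h
  have hgw : AdjoinRoot.mk (X ^ q - 1 : S[X]) g * wordToPoly q S w = 0 := by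
    refine eq_zero_of_constForm fun a => ?_
    obtain ⟨c, hc⟩ := wordToPoly_surjective
      (AdjoinRoot.mk (X ^ q - 1 : S[X]) g * rootChar q S a)
    have h := horth c (mem_cyclicCode.2 ⟨_, hc⟩)
    rw [sum_mul_eq_constForm, hc, map_mul (reversal q S), hg, reversal_rootChar] at h
    rw [← h]
    congr 1
    ring
  have hTw : (∑ i, rootChar q S i) * wordToPoly q S w =
      (∑ i, w i) • ∑ i, rootChar q S i := by
    rw [wordToPoly_eq_sum, Finset.mul_sum, Finset.sum_smul]
    refine Finset.sum_congr rfl fun a _ => ?_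
    rw [mul_smul_comm, Finset.sum_mul, ← Equiv.sum_comp (Equiv.addRight a) (rootChar q S)]
    simp [AddChar.map_add_eq_mul]
  set s : S := n * ∑ i, w i with hs
  have hmem : (fun i => w i - s) ∈ cyclicCode q g' := by
    refine mem_cyclicCode.2 ⟨wordToPoly q S w, ?_⟩
    have h1 : wordToPoly q S (fun i => w i - s) =
        wordToPoly q S w - s • ∑ i, rootChar q S i := by
      rw [← wordToPoly_const, ← map_sub]
      rfl
    have h2 : s • ∑ i, rootChar q S i =
        (n • ∑ i, rootChar q S i) * wordToPoly q S w := by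
      rw [smul_mul_assoc, hTw, smul_smul]
    rw [h1, h2]
    linear_combination (-wordToPoly q S w) * hadd + hgw
  -- Orthogonality to the border row gives ∑ w = -r x_∞, whence s r' = -n r r' x_∞ = n q x_∞ = x_∞.
  have hnone : x none = s * r' := by
    rw [hs]
    linear_combination (n * x none) * hr - x none * hn - n * r' * hsum
  have hdecomp : x = (fun t : Option (ZMod q) => t.elim 0 (fun i => w i - s)) +
      s • (fun t : Option (ZMod q) => t.elim r' (fun _ => 1)) := by
    funext t
    cases t with
    | none => simp [hnone]
    | some i => simp [hw]
  rw [hdecomp]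
  exact add_mem (Submodule.subset_span (Or.inl ⟨rfl, hmem⟩))
    (Submodule.smul_mem _ _ (Submodule.subset_span (Or.inr rfl)))

end CyclicAlgebra

/-! ### The idempotents in terms of T and G. -/

section QuadraticResidueIdempotents

variable {q : ℕ} [Fact q.Prime] {S : Type*} [CommRing S]

theorem reversal_quadSum (hq : q % 4 = 1) :
    reversal q S (quadSum (rootChar q S)) = quadSum (rootChar q S) := by
  rw [quadSum_eq, map_sum, ← Equiv.sum_comp (Equiv.neg _)]
  refine Finset.sum_congr rfl fun i _ => ?_
  rw [Equiv.neg_apply, map_mul, map_intCast, reversal_rootChar, neg_neg, neg_eq_neg_one_mul,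
    map_mul, quadraticChar_neg_one_of_mod_four hq, one_mul]

theorem dualCode_augCode {g g' : S[X]} {r r' h n l : S} (hq : q % 4 = 1)
    (hr : r * r' = -q) (hh : h * 2 = 1) (hn : n * q = 1) (hl : l ^ 2 * q = 1)
    (hg : AdjoinRoot.mk (X ^ q - 1 : S[X]) g = AdjoinRoot.of _ h *
      (1 - AdjoinRoot.of _ n * ∑ i, rootChar q S i - AdjoinRoot.of _ l * quadSum (rootChar q S)))
    (hg' : AdjoinRoot.mk (X ^ q - 1 : S[X]) g' = AdjoinRoot.of _ h *
      (1 - AdjoinRoot.of _ n * ∑ i, rootChar q S i +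
        AdjoinRoot.of _ l * quadSum (rootChar q S))) :
    dualCode (augCode (q := q) g r) = augCode g' r' := by
  have hh' := congrArg (AdjoinRoot.of (X ^ q - 1 : S[X])) hh
  have hn' := congrArg (AdjoinRoot.of (X ^ q - 1 : S[X])) hn
  have hl' := congrArg (AdjoinRoot.of (X ^ q - 1 : S[X])) hl
  simp only [map_mul, map_pow, map_one, map_natCast, map_ofNat] at hh' hn' hl'
  have hof : ∀ s : S, reversal q S (AdjoinRoot.of _ s) = AdjoinRoot.of _ s := fun s =>
    (reversal q S).commutes s
  have hG := quadSum_sq hq (rootChar q S)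
  have hTG := sum_addChar_mul_quadSum (by lia) (rootChar q S)
  have hTT := sum_addChar_mul_self (rootChar q S)
  have hτT := reversal_sum_rootChar (q := q) (S := S)
  have hτG := reversal_quadSum (S := S) hq
  have hrev : reversal q S (AdjoinRoot.mk (X ^ q - 1 : S[X]) g) =
      AdjoinRoot.mk (X ^ q - 1 : S[X]) g := by
    simp only [hg, map_mul, map_sub, map_one, hof, hτT, hτG]
  refine le_antisymm (dualCode_augCode_le hr hn ?_ hrev)
    (augCode_le_dualCode hr ?_ ?_ ?_ hrev)
  · rw [hg, hg', Algebra.smul_def, AdjoinRoot.algebraMap_eq]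
    linear_combination (1 - AdjoinRoot.of _ n * ∑ i, rootChar q S i) * hh'
  all_goals
    simp only [hg, hg']
    generalize ∑ i, rootChar q S i = T at *
    generalize quadSum (rootChar q S) = G at *
    generalize AdjoinRoot.of (X ^ q - 1 : S[X]) h = h₁ at *
    generalize AdjoinRoot.of (X ^ q - 1 : S[X]) n = n₁ at *
    generalize AdjoinRoot.of (X ^ q - 1 : S[X]) l = l₁ at *
  -- The final summand encodes l² = n, both being inverses of q.
  · linear_combination (h₁ ^ 2 * n₁ ^ 2) * hTT + (h₁ ^ 2 * n₁ * T) * hn' - h₁ ^ 2 * l₁ ^ 2 * hG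
      - h₁ ^ 2 * hl' + h₁ ^ 2 * T * (n₁ * hl' - l₁ ^ 2 * hn')
  · linear_combination (-h₁ * n₁) * hTT - h₁ * T * hn' - h₁ * l₁ * hTG
  · linear_combination (-h₁ * n₁) * hTT - h₁ * T * hn' + h₁ * l₁ * hTG

variable {p : ℕ} [Fact p.Prime]

theorem mk_map_sum_ite (φ : ZMod p →+* S) (c : ℤ) (hc : c ≠ 0) :
    AdjoinRoot.mk (X ^ q - 1 : S[X])
      ((∑ i ∈ Finset.Icc 1 (q - 1), if legendreSym q (i : ℤ) = c then X ^ i else 0 :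
        (ZMod p)[X]).map φ) =
      ∑ i, if quadraticChar (ZMod q) i = c then rootChar q S i else 0 := by
  rw [← sum_ite_quadraticChar_zmod _ c hc, Polynomial.map_sum, map_sum]
  refine Finset.sum_congr rfl fun i _ => ?_
  rw [rootChar_natCast]
  split_ifs <;> simp

theorem mk_map_jRes_add_jNonres (φ : ZMod p →+* S) :
    AdjoinRoot.mk (X ^ q - 1 : S[X]) ((jRes p q).map φ) +
      AdjoinRoot.mk (X ^ q - 1 : S[X]) ((jNonres p q).map φ) = ∑ i, rootChar q S i - 1 := by
  rw [jRes, jNonres, mk_map_sum_ite φ _ one_ne_zero, mk_map_sum_ite φ _ (by norm_num),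
    ← Finset.sum_add_distrib]
  have h : ∑ i : ZMod q, (if i = 0 then 1 else 0 : AdjoinRoot (X ^ q - 1 : S[X])) = 1 := by
    simp
  rw [← h, ← Finset.sum_sub_distrib]
  refine Finset.sum_congr rfl fun i _ => ?_
  by_cases hi : i = 0
  · simp [hi]
  · rcases quadraticChar_dichotomy hi with h | h <;> simp [h, hi, -quadraticChar_apply]

theorem mk_map_jRes_sub_jNonres (φ : ZMod p →+* S) :
    AdjoinRoot.mk (X ^ q - 1 : S[X]) ((jRes p q).map φ) -
      AdjoinRoot.mk (X ^ q - 1 : S[X]) ((jNonres p q).map φ) = quadSum (rootChar q S) := by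
  rw [jRes, jNonres, mk_map_sum_ite φ _ one_ne_zero, mk_map_sum_ite φ _ (by norm_num),
    ← Finset.sum_sub_distrib, quadSum_eq]
  refine Finset.sum_congr rfl fun i _ => ?_
  by_cases hi : i = 0
  · simp [hi]
  · rcases quadraticChar_dichotomy hi with h | h <;> simp [h, -quadraticChar_apply]

/-- Uses j₁ + j₂ = T - 1 and j₁ - j₂ = G; exchanging j₁ and j₂ only changes the sign of G. -/
theorem mk_map_expIdem (φ : ZMod p →+* S) (θ : ZMod p) (a : Fin 2) :
    AdjoinRoot.mk (X ^ q - 1 : S[X]) ((expIdem p q θ a).map φ) =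
      AdjoinRoot.of _ (φ 2⁻¹) * (1 - AdjoinRoot.of _ (φ (q : ZMod p)⁻¹) * ∑ i, rootChar q S i -
        AdjoinRoot.of _ (φ θ⁻¹ * ((![1, -1] : Fin 2 → ℤ) a : S)) * quadSum (rootChar q S)) := by
  have h := mk_map_jRes_add_jNonres (q := q) φ
  have h' := mk_map_jRes_sub_jNonres (q := q) φ
  rw [← h', eq_add_of_sub_eq h.symm]
  fin_cases a <;>
  · simp only [expIdem, Fin.zero_eta, Fin.mk_one, Matrix.cons_val, Polynomial.map_sub,
      Polynomial.map_mul, Polynomial.map_add, Polynomial.map_one, Polynomial.map_C, map_sub,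
      map_mul, map_add, AdjoinRoot.mk_C, map_one, Int.cast_one, Int.cast_neg, map_neg]
    ring

end QuadraticResidueIdempotents

/-! ### The orthogonal idempotents η_k. -/

section EtaIdempotents

variable {p : ℕ}

theorem uElt_pow_four : uElt p ^ 4 = uElt p := by
  have h := AdjoinRoot.eval₂_root (X ^ 4 - X : (ZMod p)[X])
  rw [eval₂_sub, eval₂_X_pow, eval₂_X] at h
  exact sub_eq_zero.1 h

theorem geom_sq_of_pow_four {R : Type*} [CommRing R] {w : R} (hw : w ^ 4 = w) :
    (w + w ^ 2 + w ^ 3) ^ 2 = 3 * (w + w ^ 2 + w ^ 3) := by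
  linear_combination (w ^ 2 + 2 * w + 3) * hw

/-- Multiplication by w fixes w + w² + w³, so the second factor acts on it as z + z² + z³ = 0. -/
theorem geom_mul_of_pow_four {R : Type*} [CommRing R] {w z v : R} (hw : w ^ 4 = w)
    (hz : z ^ 2 + z + 1 = 0) (hv : v = z * w) :
    (w + w ^ 2 + w ^ 3) * (v + v ^ 2 + v ^ 3) = 0 := by
  have h1 : w * (w + w ^ 2 + w ^ 3) = w + w ^ 2 + w ^ 3 := by linear_combination hw
  have h2 : w ^ 2 * (w + w ^ 2 + w ^ 3) = w + w ^ 2 + w ^ 3 := by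
    linear_combination (w + 1) * h1
  have h3 : w ^ 3 * (w + w ^ 2 + w ^ 3) = w + w ^ 2 + w ^ 3 := by
    linear_combination (w ^ 2 + w + 1) * h1
  rw [hv]
  linear_combination z * h1 + z ^ 2 * h2 + z ^ 3 * h3 + z * (w + w ^ 2 + w ^ 3) * hz

/-- With f(w) = w + w² + w³, the last three η's are f(u)/3, f(ξu)/3 and f(ξ²u)/3. The four are
orthogonal idempotents with sum 1, so only the squares of the signs survive. -/
theorem etaIdem_signed_sum_sq [Fact p.Prime] (h3 : (3 : ZMod p) ≠ 0) {ξ : ZMod p}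
    (hξ : ξ ^ 2 + ξ + 1 = 0) {e : Fin 4 → ℤ} (he : ∀ k, e k ^ 2 = 1) :
    (∑ k, etaIdem p ξ k * (e k : QRRing p)) ^ 2 = 1 := by
  have hu := uElt_pow_four (p := p)
  have he' : ∀ k, (e k : QRRing p) ^ 2 = 1 := fun k => by
    exact_mod_cast congrArg (Int.cast : ℤ → QRRing p) (he k)
  have h3' : algebraMap (ZMod p) (QRRing p) 3⁻¹ * 3 = 1 := by
    have := congrArg (algebraMap (ZMod p) (QRRing p)) (inv_mul_cancel₀ h3)
    rwa [map_mul, map_one, map_ofNat] at this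
  have hz : algebraMap (ZMod p) (QRRing p) ξ ^ 2 + algebraMap (ZMod p) (QRRing p) ξ + 1 = 0 := by
    have := congrArg (algebraMap (ZMod p) (QRRing p)) hξ
    simpa only [map_add, map_pow, map_one, map_zero] using this
  simp only [Fin.sum_univ_four, etaIdem, Algebra.smul_def, map_pow, Matrix.cons_val]
  have e0 := he' 0
  have e1 := he' 1
  have e2 := he' 2
  have e3 := he' 3
  generalize uElt p = u at *
  generalize algebraMap (ZMod p) (QRRing p) 3⁻¹ = t at *
  generalize algebraMap (ZMod p) (QRRing p) ξ = z at *
  generalize (e 0 : QRRing p) = a at *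
  generalize (e 1 : QRRing p) = b at *
  generalize (e 2 : QRRing p) = c at *
  generalize (e 3 : QRRing p) = d at *
  have z3 : z ^ 3 = 1 := by linear_combination (z - 1) * hz
  have hz2 : (z ^ 2) ^ 2 + z ^ 2 + 1 = 0 := by linear_combination (z ^ 2 - z + 1) * hz
  have hv : (z * u) ^ 4 = z * u := by linear_combination z ^ 4 * hu + z * u * z3
  have hw : (z ^ 2 * u) ^ 4 = z ^ 2 * u := by
    linear_combination z ^ 8 * hu + z ^ 2 * (z ^ 3 + 1) * u * z3
  have fv : z * u + z ^ 2 * u ^ 2 + u ^ 3 = z * u + (z * u) ^ 2 + (z * u) ^ 3 := by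
    linear_combination -u ^ 3 * z3
  have fw : z ^ 2 * u + z * u ^ 2 + u ^ 3 = z ^ 2 * u + (z ^ 2 * u) ^ 2 + (z ^ 2 * u) ^ 3 := by
    linear_combination (-z * u ^ 2 - (z ^ 3 + 1) * u ^ 3) * z3
  have fsum : (u + u ^ 2 + u ^ 3) + (z * u + z ^ 2 * u ^ 2 + u ^ 3) +
      (z ^ 2 * u + z * u ^ 2 + u ^ 3) = 3 * u ^ 3 := by
    linear_combination (u + u ^ 2) * hz
  have q1 := geom_sq_of_pow_four hu
  have q2 := geom_sq_of_pow_four hv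
  have q3 := geom_sq_of_pow_four hw
  have m12 := geom_mul_of_pow_four hu hz rfl
  have m13 := geom_mul_of_pow_four hu hz2 rfl
  have m23 := geom_mul_of_pow_four (v := z ^ 2 * u) hv hz (by ring)
  rw [← fv] at q2 m12 m23
  rw [← fw] at q3 m13 m23
  have k0 : (1 - u ^ 3) ^ 2 = 1 - u ^ 3 := by linear_combination u ^ 2 * hu
  have k1 : (1 - u ^ 3) * (u + u ^ 2 + u ^ 3) = 0 := by
    linear_combination (-1 - u - u ^ 2) * hu
  have k2 : (1 - u ^ 3) * (z * u + z ^ 2 * u ^ 2 + u ^ 3) = 0 := by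
    linear_combination (-z - z ^ 2 * u - u ^ 2) * hu
  have k3 : (1 - u ^ 3) * (z ^ 2 * u + z * u ^ 2 + u ^ 3) = 0 := by
    linear_combination (-z ^ 2 - z * u - u ^ 2) * hu
  generalize u + u ^ 2 + u ^ 3 = x at *
  generalize z * u + z ^ 2 * u ^ 2 + u ^ 3 = y at *
  generalize z ^ 2 * u + z * u ^ 2 + u ^ 3 = s at *
  have i1 : (t * x) ^ 2 = t * x := by linear_combination t ^ 2 * q1 + t * x * h3'
  have i2 : (t * y) ^ 2 = t * y := by linear_combination t ^ 2 * q2 + t * y * h3'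
  have i3 : (t * s) ^ 2 = t * s := by linear_combination t ^ 2 * q3 + t * s * h3'
  have hsum : (1 - u ^ 3) + t * x + t * y + t * s = 1 := by
    linear_combination t * fsum + u ^ 3 * h3'
  linear_combination a ^ 2 * k0 + b ^ 2 * i1 + c ^ 2 * i2 + d ^ 2 * i3 + hsum +
    (1 - u ^ 3) * e0 + t * x * e1 + t * y * e2 + t * s * e3 +
    2 * a * b * t * k1 + 2 * a * c * t * k2 + 2 * a * d * t * k3 +
    2 * b * c * t ^ 2 * m12 + 2 * b * d * t ^ 2 * m13 + 2 * c * d * t ^ 2 * m23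

theorem etaIdem_sum [Fact p.Prime] (h3 : (3 : ZMod p) ≠ 0) {ξ : ZMod p}
    (hξ : ξ ^ 2 + ξ + 1 = 0) : ∑ k, etaIdem p ξ k = 1 := by
  have h3' : algebraMap (ZMod p) (QRRing p) 3⁻¹ * 3 = 1 := by
    have := congrArg (algebraMap (ZMod p) (QRRing p)) (inv_mul_cancel₀ h3)
    rwa [map_mul, map_one, map_ofNat] at this
  have hz : algebraMap (ZMod p) (QRRing p) ξ ^ 2 + algebraMap (ZMod p) (QRRing p) ξ + 1 = 0 := by
    have := congrArg (algebraMap (ZMod p) (QRRing p)) hξ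
    simpa only [map_add, map_pow, map_one, map_zero] using this
  simp only [Fin.sum_univ_four, etaIdem, Algebra.smul_def, map_pow, Matrix.cons_val]
  linear_combination (algebraMap (ZMod p) (QRRing p) 3⁻¹ * (uElt p + uElt p ^ 2)) * hz +
    uElt p ^ 3 * h3'

end EtaIdempotents

/-! ### Duality of the extended codes and rationality of θ. -/

section QuadraticResidueCodes

variable {p q : ℕ} [Fact p.Prime] [Fact q.Prime]

/-- The signs with which the Gauss sum enters the components of the `i`-th generator. -/
def patternSign (i : ℕ) (k : Fin 4) : ℤ := (![1, -1] : Fin 2 → ℤ) (qrPattern i k)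

theorem patternSign_sq (i : ℕ) (k : Fin 4) : patternSign i k ^ 2 = 1 := by
  unfold patternSign
  generalize qrPattern i k = a
  fin_cases a <;> rfl

theorem mk_expGen (h3 : (3 : ZMod p) ≠ 0) {ξ : ZMod p} (hξ : ξ ^ 2 + ξ + 1 = 0) (θ : ZMod p)
    (i : ℕ) :
    AdjoinRoot.mk (X ^ q - 1 : (QRRing p)[X]) (expGen p q ξ θ i) =
      AdjoinRoot.of _ (algebraMap (ZMod p) (QRRing p) 2⁻¹) *
        (1 - AdjoinRoot.of _ (algebraMap (ZMod p) (QRRing p) (q : ZMod p)⁻¹) *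
            ∑ i, rootChar q (QRRing p) i -
          AdjoinRoot.of _ (algebraMap (ZMod p) (QRRing p) θ⁻¹ *
            ∑ k, etaIdem p ξ k * (patternSign i k : QRRing p)) *
            quadSum (rootChar q (QRRing p))) := by
  have hsum := congrArg (AdjoinRoot.of (X ^ q - 1 : (QRRing p)[X])) (etaIdem_sum h3 hξ)
  rw [map_sum, map_one, Fin.sum_univ_four] at hsum
  simp only [expGen, map_sum, map_mul, AdjoinRoot.mk_C, mk_map_expIdem, patternSign]
  simp only [Fin.sum_univ_four]
  linear_combination (AdjoinRoot.of _ (algebraMap (ZMod p) (QRRing p) 2⁻¹) *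
    (1 - AdjoinRoot.of _ (algebraMap (ZMod p) (QRRing p) (q : ZMod p)⁻¹) *
            ∑ i, rootChar q (QRRing p) i)) * hsum

theorem dualCode_extCode (hq : q % 4 = 1) (h2 : (2 : ZMod p) ≠ 0) (h3 : (3 : ZMod p) ≠ 0)
    (hq0 : (q : ZMod p) ≠ 0) {ξ θ : ZMod p} (hξ : ξ ^ 2 + ξ + 1 = 0) (hθ : θ ^ 2 = q) {i j : ℕ}
    (hij : ∀ k, patternSign j k = -patternSign i k)
    (hr : extEntry p q i * extEntry p q j = -(q : QRRing p)) :
    dualCode (extCode p q ξ θ i) = extCode p q ξ θ j := by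
  have hθ0 : θ ≠ 0 := by
    rintro rfl
    exact hq0 (by simpa using hθ.symm)
  have hl : (θ⁻¹ ^ 2 * q : ZMod p) = 1 := by
    rw [← hθ]
    field_simp
  refine dualCode_augCode (h := algebraMap (ZMod p) (QRRing p) 2⁻¹)
    (n := algebraMap (ZMod p) (QRRing p) (q : ZMod p)⁻¹)
    (l := algebraMap (ZMod p) (QRRing p) θ⁻¹ *
      ∑ k, etaIdem p ξ k * (patternSign i k : QRRing p)) hq hr ?_ ?_ ?_
    (mk_expGen h3 hξ θ i) ?_
  · have h := congrArg (algebraMap (ZMod p) (QRRing p)) (inv_mul_cancel₀ h2)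
    rwa [map_mul, map_one, map_ofNat] at h
  · simpa using congrArg (algebraMap (ZMod p) (QRRing p)) (inv_mul_cancel₀ hq0)
  · rw [mul_pow, etaIdem_signed_sum_sq h3 hξ (patternSign_sq i), mul_one]
    have h := congrArg (algebraMap (ZMod p) (QRRing p)) hl
    rwa [map_mul, map_pow, map_one, map_natCast] at h
  · rw [mk_expGen h3 hξ θ j]
    simp only [hij, Int.cast_neg, mul_neg, Finset.sum_neg_distrib, map_neg, neg_mul,
      sub_neg_eq_add]

theorem natCast_ne_zero_of_legendreSym (hpq : legendreSym q (p : ℤ) = 1) :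
    (q : ZMod p) ≠ 0 := by
  intro h
  rw [ZMod.natCast_eq_zero_iff, Nat.prime_dvd_prime_iff_eq Fact.out Fact.out] at h
  subst h
  have h := (legendreSym.eq_zero_iff p (p : ℤ)).2 (by simp)
  lia

/-- The square of the Gaussian sum, and its rationality over `F_p`. -/
theorem exists_gaussianSum_eq (hp2 : p ≠ 2) (hq : q % 4 = 1) (hpq : legendreSym q (p : ℤ) = 1)
    {K : Type*} [Field K] [Algebra (ZMod p) K] {β : K} (hβ : IsPrimitiveRoot β q) :
    ∃ θ : ZMod p, algebraMap (ZMod p) K θ = gaussianSum q β ∧ θ ^ 2 = q := by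
  have hsq : gaussianSum q β ^ 2 = q := by
    rw [gaussianSum_eq_quadSum hβ.pow_eq_one, quadSum_sq hq, AddChar.sum_eq_zero_of_ne_one,
      sub_zero]
    exact AddChar.zmod_char_ne_one_iff q _ |>.2 <| by
      simpa using (AddChar.zmodChar_apply' hβ.pow_eq_one 1).trans_ne
        (by simpa using hβ.ne_one (Fact.out : q.Prime).one_lt)
  have hne : ((q : ℤ) : ZMod p) ≠ 0 := by
    rw [Int.cast_natCast]
    exact natCast_ne_zero_of_legendreSym hpq
  -- By reciprocity q is a square s² in F_p, so the Gauss sum, a square root of q in K, is ±s.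
  rw [← legendreSym.quadratic_reciprocity_one_mod_four hq hp2, legendreSym.eq_one_iff p hne] at hpq
  obtain ⟨s, hs⟩ := hpq
  rw [Int.cast_natCast] at hs
  have hK : algebraMap (ZMod p) K s ^ 2 = gaussianSum q β ^ 2 := by
    rw [hsq, ← map_pow, sq, ← hs, map_natCast]
  rcases sq_eq_sq_iff_eq_or_eq_neg.1 hK with h | h
  · exact ⟨s, h, by rw [hs, sq]⟩
  · exact ⟨-s, by rw [map_neg, h, neg_neg], by rw [hs, neg_sq, sq]⟩

end QuadraticResidueCodes

theorem theorem12 (p q : ℕ) [Fact p.Prime] [Fact q.Prime]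
    (hp : p ≡ 1 [MOD 3]) (hq : q ≡ 1 [MOD 4]) (hpq : legendreSym q (p : ℤ) = 1)
    (α : ZMod p) (hα : IsPrimitiveRoot α (p - 1))
    {K : Type*} [Field K] [Algebra (ZMod p) K] (β : K) (hβ : IsPrimitiveRoot β q) :
    ∃ θ : ZMod p, algebraMap (ZMod p) K θ = gaussianSum q β ∧
      (∀ i ∈ Finset.Icc 1 4,
        dualCode (extCode p q (α ^ ((p - 1) / 3)) θ i) =
          extCode p q (α ^ ((p - 1) / 3)) θ (i + 4)) ∧
      (∀ i ∈ Finset.Icc 9 11,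
        dualCode (extCode p q (α ^ ((p - 1) / 3)) θ i) =
          extCode p q (α ^ ((p - 1) / 3)) θ (i + 3)) := by
  have hp3 : p % 3 = 1 := hp
  have hq4 : q % 4 = 1 := hq
  have hp1 : 1 < p := (Fact.out : p.Prime).one_lt
  have hp2 : p ≠ 2 := by lia
  obtain ⟨θ, hθ, hθ2⟩ := exists_gaussianSum_eq hp2 hq4 hpq hβ
  have h2 : (2 : ZMod p) ≠ 0 := by
    intro h
    have := Nat.le_of_dvd two_pos ((ZMod.natCast_eq_zero_iff 2 p).1 (by exact_mod_cast h))
    lia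
  have h3 : (3 : ZMod p) ≠ 0 := by
    intro h
    have := Nat.le_of_dvd three_pos ((ZMod.natCast_eq_zero_iff 3 p).1 (by exact_mod_cast h))
    have : p = 3 := by lia
    lia
  have hq0 : (q : ZMod p) ≠ 0 := natCast_ne_zero_of_legendreSym hpq
  -- ξ is a primitive cube root of unity because 3 divides p - 1.
  have hξ : (α ^ ((p - 1) / 3)) ^ 2 + α ^ ((p - 1) / 3) + 1 = 0 := by
    have h := hα.pow (n := p - 1) (a := (p - 1) / 3) (b := 3) (by lia) (by lia)
    have hsum := h.geom_sum_eq_zero (by norm_num)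
    simp only [Finset.sum_range_succ, Finset.sum_range_zero] at hsum
    linear_combination hsum
  refine ⟨θ, hθ, fun i hi => ?_, fun i hi => ?_⟩ <;>
  · rw [Finset.mem_Icc] at hi
    obtain ⟨hi1, hi2⟩ := hi
    refine dualCode_extCode hq4 h2 h3 hq0 hξ hθ2 (fun k => ?_) ?_
    · interval_cases i <;> fin_cases k <;> rfl
    · interval_cases i <;> simp [extEntry]
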